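/- A group $G$ is *mixed identity free* (MIF) if for every non-trivial element $w$ of the free product $G*\mathbb Z$ there is a homomorphism $\alpha\colon G*\mathbb Z\to G$ with $\alpha(g)=g$ for all $g\in G$ and $\alpha(w)\neq 1$. Let $U$ denote the Moss graph, that is, the unique (up to isomorphism) countable simple graph such that $U$ is connected, every finite connected graph embeds isometrically in $U$ (with respect to the path metrics), and every isometry between two finite sets of vertices of $U$ (with the metric induced from $U$) extends to an automorphism of $U$. A *regular representation* $G\to\operatorname{Aut}(U)$ is an injective homomorphism such that the induced action of $G$ on the set of vertices of $U$ is regular (simply transitive). Two homomorphisms $\alpha_1,\alpha_2\colon G\to\operatorname{Aut}(U)$ are *equivalent* if there is $t\in\operatorname{Aut}(U)$ with $\alpha_1(g)=t^{-1}\alpha_2(g)t$ for all $g\in G$. **Corollary.** For every countable MIF group $G$, there exists a set of cardinality $2^{\aleph_0}$ of pairwise non-equivalent regular representations $G\to\operatorname{Aut}(U)$. (Here a graph $U$ as above exists, and the claim holds for every such graph.) -/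

import Mathlib

namespace MossReps

/-- `G` satisfies a non-trivial mixed identity: some non-trivial `w` in the free product `G ∗ ℤ`
is killed by every homomorphism `G ∗ ℤ → G` that restricts to the identity on `G`. -/
def HasNontrivialMixedIdentity (G : Type*) [Group G] : Prop :=
  ∃ w : Monoid.Coprod G (Multiplicative ℤ), w ≠ 1 ∧
    ∀ α : Monoid.Coprod G (Multiplicative ℤ) →* G,
      (∀ g : G, α (Monoid.Coprod.inl g) = g) → α w = 1

/-- `G` is mixed identity free. -/
def IsMIF (G : Type*) [Group G] : Prop :=
  ¬ HasNontrivialMixedIdentity G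

/-- The properties that characterize the Moss graph (the countable universal graph for isometric
embeddings) up to isomorphism. Distances are path distances; as all graphs concerned are
connected, `SimpleGraph.dist` is the true distance. -/
structure IsMossGraph {V : Type*} (U : SimpleGraph V) : Prop where
  countable : Countable V
  connected : U.Connected
  /-- Every finite connected graph embeds isometrically in `U`. -/
  universal : ∀ (n : ℕ) (Γ : SimpleGraph (Fin n)), Γ.Connected →
    ∃ f : Fin n → V, ∀ i j : Fin n, U.dist (f i) (f j) = Γ.dist i j
  /-- Every isometry between finite sets of vertices, with the metric induced from `U`, extends
  to an automorphism of `U`. -/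
  homogeneous : ∀ (S T : Finset V) (f : S ≃ T),
    (∀ x y : S, U.dist (f x : V) (f y : V) = U.dist (x : V) (y : V)) →
      ∃ φ : U ≃g U, ∀ x : S, φ (x : V) = (f x : V)

/-- A regular representation of `G` on `U`: an injective homomorphism `G → Aut(U)` (the product
in `U ≃g U` is composition) whose induced action on the vertices is regular, that is, simply
transitive. -/
structure IsRegularRep {G V : Type*} [Group G] {U : SimpleGraph V} (α : G →* (U ≃g U)) :
    Prop where
  injective : Function.Injective α
  regular : ∀ u v : V, ∃! g : G, α g u = v

/-- Two homomorphisms `G → Aut(U)` are equivalent if an element of `Aut(U)` conjugates one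
to the other. -/
def EquivalentReps {G V : Type*} [Group G] {U : SimpleGraph V} (α₁ α₂ : G →* (U ≃g U)) : Prop :=
  ∃ t : U ≃g U, ∀ g : G, α₁ g = t⁻¹ * α₂ g * t

end MossReps

/-! A Moss graph amounts to a countable metric space with values in ℕ that realizes every finite
one-point extension. Such spaces are all isometric, by back and forth. Hence a norm on G whose left
invariant metric has this property identifies G with the vertices of any Moss graph, and left
multiplication becomes a regular representation. If two of these representations are equivalent,
then the norms are conjugate in G; as G is countable, each conjugacy class of norms is countable. So
continuum many generic norms suffice.

They come from Baire category. The norms form a Polish space, closed in the product ℕ^G. For each of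
the countably many finite extension problems, the norms that solve it or are inconsistent with it
form an open set, dense by `IsMIF.exists_norm_extension`. No norm is isolated, so the generic norms
are an uncountable Borel set and contain a copy of the Cantor set.

Density is where MIF enters. Adjoin a formal solution x and give finitely many words of G ∗ ℤ their
desired lengths as weights. An action of G ∗ ℤ on functions G → ℤ that preserves the supremum
distance shows that no product of these words undercuts a weight. Only finitely many words need to
stay non-trivial for this to survive in G, and MIF provides a single value of x for all of them,
since a suitable commutator of conjugates merges two non-trivial words into one
(`IsMIF.exists_hom_forall`, `IsMIF.exists_norm`). -/

namespace MossReps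

/-! ### Integer metrics and their unit distance graphs. -/

/-- A metric with values in the natural numbers. -/
structure IsNatMetric {V : Type*} (d : V → V → ℕ) : Prop where
  eq_zero_iff : ∀ x y, d x y = 0 ↔ x = y
  symm : ∀ x y, d x y = d y x
  triangle : ∀ x y z, d x z ≤ d x y + d y z

/-- The finite set `s` of pairs (point, prescribed distance) describes a one-point extension of a
finite metric space. -/
def IsKatetov {V : Type*} (d : V → V → ℕ) (s : Finset (V × ℕ)) : Prop :=
  (∀ p ∈ s, 0 < p.2) ∧
    ∀ p ∈ s, ∀ q ∈ s, p.2 ≤ q.2 + d p.1 q.1 ∧ d p.1 q.1 ≤ p.2 + q.2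

/-- All finite one-point extensions are realized. -/
def HasExtensions {V : Type*} (d : V → V → ℕ) : Prop :=
  ∀ s : Finset (V × ℕ), IsKatetov d s → ∃ v, ∀ p ∈ s, d v p.1 = p.2

/-- The graph of pairs at distance one. -/
def unitGraph {V : Type*} {d : V → V → ℕ} (hd : IsNatMetric d) : SimpleGraph V where
  Adj x y := d x y = 1
  symm := ⟨fun x y h => by rw [hd.symm]; exact h⟩
  loopless := ⟨fun x h => by rw [(hd.eq_zero_iff x x).2 rfl] at h; omega⟩

section UnitGraph

variable {V : Type*} {d : V → V → ℕ} (hd : IsNatMetric d)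

include hd in
theorem IsNatMetric.self (x : V) : d x x = 0 := (hd.eq_zero_iff x x).2 rfl

theorem le_length_unitGraph {x y : V} (w : (unitGraph hd).Walk x y) : d x y ≤ w.length := by
  induction w with
  | nil => simp [hd.self]
  | @cons a b c h w ih =>
    have h1 : d a b = 1 := h
    have := hd.triangle a b c
    simp only [SimpleGraph.Walk.length_cons]
    omega

theorem exists_walk_unitGraph
    (hgeod : ∀ x y, 2 ≤ d x y → ∃ z, d x z = 1 ∧ d z y + 1 = d x y) (n : ℕ) :
    ∀ x y, d x y = n → ∃ w : (unitGraph hd).Walk x y, w.length = n := by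
  induction n with
  | zero =>
    intro x y h
    obtain rfl := (hd.eq_zero_iff x y).1 h
    exact ⟨.nil, rfl⟩
  | succ n ih =>
    intro x y h
    obtain ⟨z, hz, hzy⟩ : ∃ z, d x z = 1 ∧ d z y + 1 = d x y := by
      rcases Nat.lt_or_ge (d x y) 2 with h2 | h2
      · exact ⟨y, by omega, by rw [hd.self]; omega⟩
      · exact hgeod x y h2
    obtain ⟨w, hw⟩ := ih z y (by omega)
    exact ⟨.cons (show (unitGraph hd).Adj x z from hz) w, by simp [hw]⟩

theorem unitGraph_connected [Nonempty V]
    (hgeod : ∀ x y, 2 ≤ d x y → ∃ z, d x z = 1 ∧ d z y + 1 = d x y) :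
    (unitGraph hd).Connected :=
  ⟨fun x y => let ⟨w, _⟩ := exists_walk_unitGraph hd hgeod _ x y rfl; ⟨w⟩⟩

theorem unitGraph_dist
    (hgeod : ∀ x y, 2 ≤ d x y → ∃ z, d x z = 1 ∧ d z y + 1 = d x y) (x y : V) :
    (unitGraph hd).dist x y = d x y := by
  obtain ⟨w, hw⟩ := exists_walk_unitGraph hd hgeod _ x y rfl
  apply le_antisymm
  · rw [← hw]; exact SimpleGraph.dist_le w
  · obtain ⟨w', hw'⟩ := SimpleGraph.Reachable.exists_walk_length_eq_dist ⟨w⟩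
    rw [← hw']; exact le_length_unitGraph hd w'

include hd in
-- Distances 1 to x and `d x y - 1` to y are a consistent prescription; 2 ≤ `d x y` keeps the second
-- one positive.
theorem HasExtensions.geodesic (hE : HasExtensions d) (x y : V) (h : 2 ≤ d x y) :
    ∃ z, d x z = 1 ∧ d z y + 1 = d x y := by
  classical
  obtain ⟨z, hz⟩ := hE {(x, 1), (y, d x y - 1)} (by
    constructor
    · simp; omega
    · simp [hd.self, hd.symm y x]; omega)
  have h1 := hz (x, 1) (by simp)
  have h2 := hz (y, d x y - 1) (by simp)
  simp only at h1 h2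
  exact ⟨z, by rw [hd.symm, h1], by omega⟩

end UnitGraph

theorem connected_isNatMetric {V : Type*} {U : SimpleGraph V} (hU : U.Connected) :
    IsNatMetric U.dist where
  eq_zero_iff _ _ := hU.dist_eq_zero_iff
  symm _ _ := SimpleGraph.dist_comm
  triangle _ _ _ := hU.dist_triangle

theorem dist_iso_le {V : Type*} {U : SimpleGraph V} (hU : U.Connected) (φ : U ≃g U) (x y : V) :
    U.dist (φ x) (φ y) ≤ U.dist x y := by
  obtain ⟨w, hw⟩ := hU.exists_walk_length_eq_dist x y
  rw [← hw, ← SimpleGraph.Walk.length_map φ.toHom w]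
  exact SimpleGraph.dist_le _

theorem dist_iso {V : Type*} {U : SimpleGraph V} (hU : U.Connected) (φ : U ≃g U) (x y : V) :
    U.dist (φ x) (φ y) = U.dist x y := by
  refine le_antisymm (dist_iso_le hU φ x y) ?_
  simpa using dist_iso_le hU φ.symm (φ x) (φ y)

/-! ### Back and forth. -/

section BackAndForth

variable {V W : Type*} {d : V → V → ℕ} {e : W → W → ℕ}

/-- Finite partial isometries, as finite sets of pairs. -/
def PartialIsometry (d : V → V → ℕ) (e : W → W → ℕ) :=
  {s : Finset (V × W) // ∀ p ∈ s, ∀ q ∈ s, d p.1 q.1 = e p.2 q.2}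

instance : Preorder (PartialIsometry d e) :=
  inferInstanceAs (Preorder {s : Finset (V × W) // ∀ p ∈ s, ∀ q ∈ s, d p.1 q.1 = e p.2 q.2})

/-- The distances from v, carried over to the image, are an extension problem. A v already in the
domain is treated apart, since prescribed distances must be positive. -/
theorem PartialIsometry.exists_image (hd : IsNatMetric d) (hE : HasExtensions e)
    (s : PartialIsometry d e) (v : V) :
    ∃ w, ∀ p ∈ s.1, d v p.1 = e w p.2 := by
  classical
  by_cases hv : ∃ w, (v, w) ∈ s.1
  · obtain ⟨w, hw⟩ := hv
    exact ⟨w, fun p hp => s.2 _ hw _ hp⟩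
  · obtain ⟨w, hw⟩ := hE (s.1.image fun p => (p.2, d v p.1)) (by
      constructor
      · simp only [Finset.forall_mem_image]
        intro p hp
        rw [Nat.pos_iff_ne_zero, Ne, hd.eq_zero_iff]
        rintro rfl
        exact hv ⟨p.2, hp⟩
      · simp only [Finset.forall_mem_image]
        intro p hp q hq
        rw [← s.2 p hp q hq]
        have h1 := hd.triangle v q.1 p.1
        have h2 := hd.triangle p.1 v q.1
        rw [hd.symm q.1 p.1] at h1
        rw [hd.symm p.1 v] at h2
        exact ⟨h1, h2⟩)
    simp only [Finset.forall_mem_image] at hw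
    exact ⟨w, fun p hp => (hw hp).symm⟩

/-- Adding a pair to a partial isometry. -/
theorem PartialIsometry.exists_insert (hd : IsNatMetric d) (he : IsNatMetric e)
    (s : PartialIsometry d e) (v : V) (w : W) (h : ∀ p ∈ s.1, d v p.1 = e w p.2) :
    ∃ t : PartialIsometry d e, (v, w) ∈ t.1 ∧ s ≤ t := by
  classical
  refine ⟨⟨insert (v, w) s.1, ?_⟩, Finset.mem_insert_self _ _, Finset.subset_insert _ _⟩
  intro p hp q hq
  rcases Finset.mem_insert.1 hp with rfl | hp <;> rcases Finset.mem_insert.1 hq with rfl | hq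
  · simp [hd.self, he.self]
  · exact h q hq
  · rw [hd.symm, he.symm]; exact h p hp
  · exact s.2 p hp q hq

/-- Back and forth: a finite partial isometry between countable spaces with all one-point
extensions extends to an isometry. -/
theorem PartialIsometry.exists_equiv [Countable V] [Countable W] (hd : IsNatMetric d)
    (he : IsNatMetric e) (hD : HasExtensions d) (hE : HasExtensions e)
    (s : PartialIsometry d e) :
    ∃ φ : V ≃ W, (∀ x y, e (φ x) (φ y) = d x y) ∧ ∀ p ∈ s.1, φ p.1 = p.2 := by
  classical
  cases nonempty_encodable V
  cases nonempty_encodable W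
  let L : V → Order.Cofinal (PartialIsometry d e) := fun v =>
    ⟨{t | ∃ w, (v, w) ∈ t.1}, fun t => by
      obtain ⟨w, hw⟩ := t.exists_image hd hE v
      obtain ⟨t', h1, h2⟩ := t.exists_insert hd he v w hw
      exact ⟨t', ⟨w, h1⟩, h2⟩⟩
  let R : W → Order.Cofinal (PartialIsometry d e) := fun w =>
    ⟨{t | ∃ v, (v, w) ∈ t.1}, fun t => by
      let t₁ : PartialIsometry e d := ⟨t.1.image Prod.swap, by
        simp only [Finset.forall_mem_image]
        intro p hp q hq
        exact (t.2 p hp q hq).symm⟩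
      obtain ⟨v, hv⟩ := t₁.exists_image he hD w
      obtain ⟨t', h1, h2⟩ := t.exists_insert hd he v w (fun p hp =>
        (hv p.swap (Finset.mem_image_of_mem _ hp)).symm)
      exact ⟨t', ⟨v, h1⟩, h2⟩⟩
  -- An ideal meeting all these cofinal sets is directed, so its union is the graph of a total,
  -- surjective isometry.
  let I := Order.idealOfCofinals s (Sum.elim L R)
  have hL : ∀ v, ∃ w, ∃ t ∈ I, (v, w) ∈ t.1 := fun v => by
    obtain ⟨t, ⟨w, hw⟩, ht⟩ := Order.cofinal_meets_idealOfCofinals s (Sum.elim L R) (Sum.inl v)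
    exact ⟨w, t, ht, hw⟩
  have hR : ∀ w, ∃ v, ∃ t ∈ I, (v, w) ∈ t.1 := fun w => by
    obtain ⟨t, ⟨v, hv⟩, ht⟩ := Order.cofinal_meets_idealOfCofinals s (Sum.elim L R) (Sum.inr w)
    exact ⟨v, t, ht, hv⟩
  have key : ∀ p q, (∃ t ∈ I, p ∈ t.1) → (∃ t ∈ I, q ∈ t.1) → d p.1 q.1 = e p.2 q.2 := by
    rintro p q ⟨t, ht, hp⟩ ⟨t', ht', hq⟩
    obtain ⟨m, -, hm, hm'⟩ := I.directed _ ht _ ht'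
    exact m.2 p (hm hp) q (hm' hq)
  choose φ hφ using hL
  choose ψ hψ using hR
  refine ⟨⟨φ, ψ, fun v => ?_, fun w => ?_⟩, fun x y => (key _ _ (hφ x) (hφ y)).symm,
    fun p hp => ?_⟩
  · rw [← hd.eq_zero_iff, key _ _ (hψ (φ v)) (hφ v)]
    exact he.self _
  · rw [← he.eq_zero_iff, ← key _ _ (hφ (ψ w)) (hψ w)]
    exact hd.self _
  · have := key _ _ (hφ p.1) ⟨s, Order.mem_idealOfCofinals s _, hp⟩
    simp only [hd.self] at this
    exact (he.eq_zero_iff _ _).1 this.symm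

end BackAndForth

theorem exists_embedding_of_hasExtensions {V : Type*} {d : V → V → ℕ} [Nonempty V]
    (hd : IsNatMetric d) (hD : HasExtensions d) (n : ℕ) (e : Fin n → Fin n → ℕ)
    (he : IsNatMetric e) : ∃ f : Fin n → V, ∀ i j, d (f i) (f j) = e i j := by
  classical
  induction n with
  | zero => exact ⟨fun i => i.elim0, fun i => i.elim0⟩
  | succ n ih =>
    obtain ⟨f, hf⟩ := ih (fun i j => e i.castSucc j.castSucc)
      ⟨fun x y => by simp [he.eq_zero_iff], fun x y => he.symm _ _, fun x y z => he.triangle _ _ _⟩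
    obtain ⟨v, hv⟩ := hD (Finset.univ.image fun i => (f i, e (Fin.last n) i.castSucc)) (by
      constructor
      · simp only [Finset.forall_mem_image]
        intro i _
        rw [Nat.pos_iff_ne_zero, Ne, he.eq_zero_iff]
        exact (Fin.castSucc_lt_last i).ne'
      · simp only [Finset.forall_mem_image]
        intro i _ j _
        rw [hf]
        have h1 := he.triangle (Fin.last n) j.castSucc i.castSucc
        have h2 := he.triangle i.castSucc (Fin.last n) j.castSucc
        rw [he.symm j.castSucc] at h1
        rw [he.symm i.castSucc (Fin.last n)] at h2
        exact ⟨h1, h2⟩)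
    simp only [Finset.forall_mem_image, Finset.mem_univ, true_imp_iff] at hv
    refine ⟨Fin.snoc f v, fun i j => ?_⟩
    induction i using Fin.lastCases with
    | last =>
      induction j using Fin.lastCases with
      | last => simp [hd.self, he.self]
      | cast j => simpa using @hv j
    | cast i =>
      induction j using Fin.lastCases with
      | last => simpa [hd.symm _ v, he.symm _ (Fin.last n)] using @hv i
      | cast j => simpa using hf i j

/-- A countable space with all one-point extensions is the vertex set of a Moss graph. -/
theorem isMossGraph_unitGraph {V : Type*} {d : V → V → ℕ} [Nonempty V] [Countable V]
    (hd : IsNatMetric d) (hD : HasExtensions d) : IsMossGraph (unitGraph hd) where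
  countable := inferInstance
  connected := unitGraph_connected hd (hD.geodesic hd)
  universal n Γ hΓ := by
    obtain ⟨f, hf⟩ := exists_embedding_of_hasExtensions hd hD n _
      (connected_isNatMetric hΓ)
    exact ⟨f, fun i j => by rw [unitGraph_dist hd (hD.geodesic hd), hf]⟩
  homogeneous S T f hf := by
    classical
    simp only [unitGraph_dist hd (hD.geodesic hd)] at hf
    let s : PartialIsometry d d := ⟨Finset.univ.image fun x : S => ((x : V), (f x : V)), by
      simp only [Finset.forall_mem_image, Finset.mem_univ, true_imp_iff]
      exact fun x y => (hf x y).symm⟩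
    obtain ⟨φ, h1, h2⟩ := s.exists_equiv hd hd hD hD
    refine ⟨⟨φ, fun {x y} => ?_⟩, fun x => ?_⟩
    · change d _ _ = 1 ↔ d _ _ = 1
      rw [h1]
    · exact h2 _ (Finset.mem_image_of_mem _ (Finset.mem_univ x))

/-! ### Finite integer metric spaces inside finite graphs. -/

section KingGraph

variable {Y : Type*} [Fintype Y] {N : ℕ}

/-- The supremum metric on a finite power of an interval of natural numbers. -/
def supDist (u v : Y → Fin (N + 1)) : ℕ := Finset.univ.sup fun k => Nat.dist (u k) (v k)

theorem supDist_le_iff {u v : Y → Fin (N + 1)} {n : ℕ} :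
    supDist u v ≤ n ↔ ∀ k, Nat.dist (u k) (v k) ≤ n := by
  simp [supDist]

theorem isNatMetric_supDist : IsNatMetric (supDist : (Y → Fin (N + 1)) → _ → ℕ) where
  eq_zero_iff u v := by
    rw [← Nat.le_zero, supDist_le_iff]
    constructor
    · exact fun h => funext fun k => Fin.ext (Nat.eq_of_dist_eq_zero (Nat.le_zero.1 (h k)))
    · rintro rfl k
      simp
  symm u v := by simp only [supDist, Nat.dist_comm]
  triangle u v w := supDist_le_iff.2 fun k => by
    refine le_trans ?_ (Nat.add_le_add (supDist_le_iff.1 le_rfl k) (supDist_le_iff.1 le_rfl k))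
    simp only [Nat.dist]
    omega

/-- All coordinates move one step towards v simultaneously. -/
theorem supDist_geodesic (u v : Y → Fin (N + 1)) (h : 2 ≤ supDist u v) :
    ∃ z, supDist u z = 1 ∧ supDist z v + 1 = supDist u v := by
  let z : Y → Fin (N + 1) := fun k =>
    ⟨if (u k : ℕ) < v k then u k + 1 else if (v k : ℕ) < u k then u k - 1 else u k, by
      have := (u k).2; have := (v k).2; split_ifs <;> omega⟩
  have h1 : supDist u z ≤ 1 := supDist_le_iff.2 fun k => by
    simp only [z, Nat.dist]; split_ifs <;> omega
  have h2 : supDist z v ≤ supDist u v - 1 := supDist_le_iff.2 fun k => by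
    have := supDist_le_iff.1 (le_refl (supDist u v)) k
    simp only [z, Nat.dist] at *; split_ifs <;> omega
  have h3 := isNatMetric_supDist.triangle u z v
  exact ⟨z, by omega, by omega⟩

/-- Finite spaces with integral distances embed isometrically into finite connected graphs. -/
theorem exists_finite_graph [Nonempty Y] (D : Y → Y → ℕ) (h0 : ∀ x, D x x = 0)
    (hs : ∀ x y, D x y = D y x) (ht : ∀ x y z, D x z ≤ D x y + D y z) :
    ∃ (n : ℕ) (Γ : SimpleGraph (Fin n)) (f : Y → Fin n), Γ.Connected ∧
      ∀ x y, Γ.dist (f x) (f y) = D x y := by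
  classical
  let N := Finset.univ.sup fun p : Y × Y => D p.1 p.2
  have hN : ∀ x y, D x y < N + 1 := fun x y =>
    Nat.lt_succ_of_le (Finset.le_sup (f := fun p : Y × Y => D p.1 p.2) (Finset.mem_univ (x, y)))
  let E := Fintype.equivFin (Y → Fin (N + 1))
  let δ : Fin (Fintype.card (Y → Fin (N + 1))) → Fin (Fintype.card (Y → Fin (N + 1))) → ℕ :=
    fun i j => supDist (E.symm i) (E.symm j)
  have hδ : IsNatMetric δ :=
    ⟨fun x y => by simp [δ, isNatMetric_supDist.eq_zero_iff],
      fun x y => isNatMetric_supDist.symm _ _, fun x y z => isNatMetric_supDist.triangle _ _ _⟩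
  have hg : ∀ x y, 2 ≤ δ x y → ∃ z, δ x z = 1 ∧ δ z y + 1 = δ x y := fun x y h => by
    obtain ⟨z, hz⟩ := supDist_geodesic _ _ h
    exact ⟨E z, by simpa [δ] using hz⟩
  have : Nonempty (Fin (Fintype.card (Y → Fin (N + 1)))) := ⟨E fun _ => 0⟩
  -- Kuratowski embedding: y goes to its distance function.
  refine ⟨_, unitGraph hδ, fun y => E fun k => ⟨D y k, hN y k⟩, unitGraph_connected hδ hg,
    fun x y => ?_⟩
  rw [unitGraph_dist hδ hg]
  simp only [δ, Equiv.symm_apply_apply]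
  apply le_antisymm
  · refine supDist_le_iff.2 fun k => ?_
    have := ht x y k
    have := ht y x k
    have := hs x y
    simp only [Nat.dist]
    omega
  · have := supDist_le_iff.1 (le_refl (supDist (fun k => ⟨D x k, hN x k⟩ : Y → Fin (N + 1))
      (fun k => ⟨D y k, hN y k⟩))) y
    simp only [Nat.dist, h0] at this
    omega

end KingGraph

/-! ### Moss graphs have all one-point extensions. -/

/-- Homogeneity, for partial isometries given as sets of pairs. -/
theorem IsMossGraph.exists_iso {V : Type*} {U : SimpleGraph V} (hU : IsMossGraph U)
    (s : PartialIsometry U.dist U.dist) : ∃ φ : U ≃g U, ∀ p ∈ s.1, φ p.1 = p.2 := by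
  classical
  have hd := connected_isNatMetric hU.connected
  have hg : ∀ x : s.1.image Prod.fst, ∃ y, ((x : V), y) ∈ s.1 := fun x => by
    obtain ⟨p, hp, hx⟩ := Finset.mem_image.1 x.2
    exact ⟨p.2, by rw [← hx]; exact hp⟩
  choose g hg using hg
  let f : s.1.image Prod.fst → s.1.image Prod.snd := fun x =>
    ⟨g x, Finset.mem_image_of_mem Prod.snd (hg x)⟩
  have hf : ∀ x y, U.dist (f x : V) (f y : V) = U.dist (x : V) (y : V) := fun x y =>
    (s.2 _ (hg x) _ (hg y)).symm
  have hp : ∀ p (hp : p ∈ s.1), g ⟨p.1, Finset.mem_image_of_mem Prod.fst hp⟩ = p.2 := by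
    intro p hp
    rw [← hd.eq_zero_iff, ← s.2 _ (hg _) _ hp]
    exact hd.self _
  have hbij : Function.Bijective f := by
    constructor
    · intro x y hxy
      apply Subtype.ext
      rw [← hd.eq_zero_iff, ← hf, hxy, hd.self]
    · rintro ⟨y, hy⟩
      obtain ⟨p, hps, rfl⟩ := Finset.mem_image.1 hy
      exact ⟨⟨p.1, Finset.mem_image_of_mem Prod.fst hps⟩, Subtype.ext (hp p hps)⟩
  obtain ⟨φ, hφ⟩ := hU.homogeneous _ _ (Equiv.ofBijective f hbij) hf
  exact ⟨φ, fun p hps => (hφ ⟨p.1, Finset.mem_image_of_mem Prod.fst hps⟩).trans (hp p hps)⟩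

/-- By universality, s with a new point has an isometric copy in U; homogeneity moves the copy of s
back onto s, and the new point goes along. -/
theorem IsMossGraph.hasExtensions {V : Type*} {U : SimpleGraph V} (hU : IsMossGraph U) :
    HasExtensions U.dist := by
  classical
  intro s hs
  have hd := connected_isNatMetric hU.connected
  let D : Option s → Option s → ℕ := fun x y =>
    match x, y with
    | none, none => 0
    | none, some q => q.1.2
    | some p, none => p.1.2
    | some p, some q => U.dist p.1.1 q.1.1
  have h0 : ∀ x, D x x = 0 := by rintro (_ | p) <;> simp [D]
  have hsymm : ∀ x y, D x y = D y x := by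
    rintro (_ | p) (_ | q) <;> simp [D, SimpleGraph.dist_comm]
  have ht : ∀ x y z, D x z ≤ D x y + D y z := by
    rintro (_ | p) (_ | q) (_ | r) <;> simp only [D]
    · omega
    · omega
    · omega
    · have := (hs.2 r r.2 q q.2).1
      rw [hd.symm] at this
      exact this
    · omega
    · exact (hs.2 p p.2 r r.2).2
    · have := (hs.2 p p.2 q q.2).1
      omega
    · exact hd.triangle _ _ _
  obtain ⟨n, Γ, f, hΓ, hf⟩ := exists_finite_graph D h0 hsymm ht
  obtain ⟨F, hF⟩ := hU.universal n Γ hΓ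
  let t : PartialIsometry U.dist U.dist :=
    ⟨Finset.univ.image fun p : s => (F (f (some p)), p.1.1), by
      simp only [Finset.forall_mem_image, Finset.mem_univ, true_imp_iff]
      exact fun p q => by rw [hF, hf]⟩
  obtain ⟨φ, hφ⟩ := hU.exists_iso t
  refine ⟨φ (F (f none)), fun p hp => ?_⟩
  have h1 : φ (F (f (some ⟨p, hp⟩))) = p.1 :=
    hφ _ (Finset.mem_image_of_mem (fun p : s => (F (f (some p)), p.1.1))
      (Finset.mem_univ (⟨p, hp⟩ : s)))
  rw [← h1, dist_iso hU.connected φ, hF, hf]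

/-! ### Reduced words in free products. -/

section FreeProduct

open Monoid Monoid.CoprodI

variable {ι : Type*} {M : ι → Type*} [∀ i, Group (M i)]

theorem neWord_prod_ne_one {i j : ι} (w : NeWord M i j) : w.prod ≠ 1 := by
  classical
  intro h
  have h1 : w.toWord = Word.empty := by
    apply Word.equiv.symm.injective
    change w.toWord.prod = Word.empty.prod
    rw [Word.prod_empty]
    exact h
  exact w.toList_ne_nil (congrArg Word.toList h1)

theorem exists_neWord {u : CoprodI M} (hu : u ≠ 1) :
    ∃ (i j : ι) (w : NeWord M i j), w.prod = u := by
  classical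
  have hu' : (Word.equiv u).prod = u := Word.equiv.symm_apply_apply u
  obtain ⟨i, j, w, hw⟩ := NeWord.of_word (Word.equiv u) (by
    intro h
    rw [h, Word.prod_empty] at hu'
    exact hu hu'.symm)
  refine ⟨i, j, w, ?_⟩
  rw [NeWord.prod, hw, hu']

/-- A non-trivial element of a free product is conjugate to a reduced word with both ends in a
given infinite factor. -/
theorem exists_conj_neWord (k : ι) [Infinite (M k)] {u : CoprodI M} (hu : u ≠ 1) :
    ∃ (c : CoprodI M) (w : NeWord M k k), w.prod = c * u * c⁻¹ := by
  classical
  -- Conjugation by such an x causes no full cancellation with a first letter y.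
  have avoid : ∀ y : M k, ∃ x : M k, x ≠ 1 ∧ x * y ≠ 1 := fun y => by
    obtain ⟨x, hx⟩ := Infinite.exists_notMem_finset ({1, y⁻¹} : Finset (M k))
    simp only [Finset.mem_insert, Finset.mem_singleton, not_or] at hx
    exact ⟨x, hx.1, fun h => hx.2 (eq_inv_of_mul_eq_one_left h)⟩
  have head : ∀ {j : ι} (w : NeWord M k j), j ≠ k →
      ∃ (c : CoprodI M) (w' : NeWord M k k), w'.prod = c * w.prod * c⁻¹ := by
    intro j w hj
    obtain ⟨x, hx, hxw⟩ := avoid w.head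
    refine ⟨of x, (w.mulHead x hxw).append hj (.singleton x⁻¹ (inv_ne_one.2 hx)), ?_⟩
    rw [NeWord.append_prod, NeWord.mulHead_prod, NeWord.prod_singleton, map_inv]
  obtain ⟨i, j, w, rfl⟩ := exists_neWord hu
  by_cases hi : i = k
  · subst hi
    by_cases hj : j = i
    · subst hj
      exact ⟨1, w, by simp⟩
    · exact head w hj
  · by_cases hj : j = k
    · subst hj
      obtain ⟨c, w', hw'⟩ := head w.inv hi
      refine ⟨c, w'.inv, ?_⟩
      rw [NeWord.inv_prod, hw', NeWord.inv_prod]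
      group
    · obtain ⟨x, hx, -⟩ := avoid 1
      refine ⟨of x, ((NeWord.singleton x hx).append (Ne.symm hi) w).append hj
        (.singleton x⁻¹ (inv_ne_one.2 hx)), ?_⟩
      simp only [NeWord.append_prod, NeWord.prod_singleton, map_inv]

/-- After conjugation both words begin and end in factor k; a letter s of factor l between them
makes the commutator of w and s w' s⁻¹ a reduced word. -/
theorem exists_commutator_conj_ne_one {k l : ι} (hkl : k ≠ l) [Infinite (M k)] [Nontrivial (M l)]
    {u v : CoprodI M} (hu : u ≠ 1) (hv : v ≠ 1) :
    ∃ h : CoprodI M, u * (h * v * h⁻¹) * u⁻¹ * (h * v * h⁻¹)⁻¹ ≠ 1 := by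
  obtain ⟨c, w, hw⟩ := exists_conj_neWord k hu
  obtain ⟨d, w', hw'⟩ := exists_conj_neWord k hv
  obtain ⟨g, hg⟩ := exists_ne (1 : M l)
  let s : NeWord M l l := .singleton g hg
  have key := neWord_prod_ne_one (((w.append hkl (s.append hkl.symm (w'.append hkl s.inv))).append
    hkl.symm w.inv).append hkl (s.append hkl.symm (w'.inv.append hkl s.inv)))
  simp only [NeWord.append_prod, NeWord.inv_prod, hw, hw'] at key
  refine ⟨c⁻¹ * s.prod * d, fun h => key ?_⟩
  have h2 := congrArg (fun z => c * z * c⁻¹) h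
  simp only [mul_one, mul_inv_cancel] at h2
  rw [← h2]
  group

end FreeProduct

/-! ### Mixed identity free groups. -/

section MIF

open Monoid

variable {G : Type*} [Group G]

/-- The two factors of `G ∗ ℤ`, in one universe. -/
abbrev Factor (G : Type*) : Bool → Type _
  | true => G
  | false => ULift (Multiplicative ℤ)

instance factorGroup : ∀ b, Group (Factor G b)
  | true => inferInstanceAs (Group G)
  | false => inferInstanceAs (Group (ULift (Multiplicative ℤ)))

theorem exists_coprodI_equiv (G : Type*) [Group G] :
    Nonempty (Coprod G (Multiplicative ℤ) ≃* CoprodI (Factor G)) := by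
  let a : G →* CoprodI (Factor G) := CoprodI.of (M := Factor G) (i := true)
  let b : ULift (Multiplicative ℤ) →* CoprodI (Factor G) := CoprodI.of (M := Factor G) (i := false)
  let Φ : Coprod G (Multiplicative ℤ) →* CoprodI (Factor G) :=
    Coprod.lift a (b.comp MulEquiv.ulift.symm.toMonoidHom)
  let f : ∀ i, Factor G i →* Coprod G (Multiplicative ℤ)
    | true => (Coprod.inl : G →* Coprod G (Multiplicative ℤ))
    | false => (Coprod.inr : Multiplicative ℤ →* Coprod G (Multiplicative ℤ)).comp
        (MulEquiv.ulift.toMonoidHom : ULift (Multiplicative ℤ) →* Multiplicative ℤ)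
  let Ψ : CoprodI (Factor G) →* Coprod G (Multiplicative ℤ) := CoprodI.lift f
  have h1 : Ψ.comp Φ = MonoidHom.id _ := by
    apply Coprod.hom_ext
    · ext g
      exact CoprodI.lift_of f (i := true) g
    · apply MonoidHom.ext
      intro n
      exact CoprodI.lift_of f (i := false) (ULift.up n)
  have h2 : Φ.comp Ψ = MonoidHom.id _ := by
    apply CoprodI.ext_hom
    rintro (_ | _)
    · apply MonoidHom.ext
      intro n
      change Φ (Ψ (CoprodI.of n)) = CoprodI.of n
      rw [CoprodI.lift_of f (i := false) n]
      rfl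
    · apply MonoidHom.ext
      intro n
      change Φ (Ψ (CoprodI.of n)) = CoprodI.of n
      rw [CoprodI.lift_of f (i := true) n]
      rfl
  exact ⟨MonoidHom.toMulEquiv Φ Ψ h1 h2⟩

theorem IsMIF.exists_hom (hG : IsMIF G) {w : Coprod G (Multiplicative ℤ)} (hw : w ≠ 1) :
    ∃ α : Coprod G (Multiplicative ℤ) →* G, (∀ g, α (Coprod.inl g) = g) ∧ α w ≠ 1 := by
  by_contra! h
  exact hG ⟨w, hw, h⟩

theorem IsMIF.nontrivial (hG : IsMIF G) : Nontrivial G := by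
  obtain ⟨α, -, hα⟩ := hG.exists_hom (w := Coprod.inr (Multiplicative.ofAdd 1)) (by
    intro h
    have := congrArg (Coprod.snd : Coprod G (Multiplicative ℤ) →* _) h
    simp at this)
  exact ⟨_, _, hα⟩

theorem IsMIF.exists_commutator_conj_ne_one (hG : IsMIF G) {u v : Coprod G (Multiplicative ℤ)}
    (hu : u ≠ 1) (hv : v ≠ 1) :
    ∃ h, u * (h * v * h⁻¹) * u⁻¹ * (h * v * h⁻¹)⁻¹ ≠ 1 := by
  obtain ⟨e⟩ := exists_coprodI_equiv G
  have : Nontrivial (Factor G true) := hG.nontrivial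
  have : Infinite (Factor G false) := inferInstanceAs (Infinite (ULift (Multiplicative ℤ)))
  obtain ⟨h, hh⟩ := MossReps.exists_commutator_conj_ne_one (M := Factor G) (k := false)
    (l := true) (by simp) (u := e u) (v := e v) (by simpa using hu) (by simpa using hv)
  refine ⟨e.symm h, fun h1 => hh ?_⟩
  have := congrArg e h1
  simpa using this

/-- In a mixed identity free group, finitely many non-trivial words are simultaneously
non-trivial under a single evaluation. -/
theorem IsMIF.exists_hom_forall (hG : IsMIF G) (s : Finset (Coprod G (Multiplicative ℤ)))
    (hs : ∀ w ∈ s, w ≠ 1) :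
    ∃ α : Coprod G (Multiplicative ℤ) →* G, (∀ g, α (Coprod.inl g) = g) ∧ ∀ w ∈ s, α w ≠ 1 := by
  classical
  -- One word u witnesses the whole set: a commutator dies as soon as one of its entries does.
  suffices h : ∃ u : Coprod G (Multiplicative ℤ), u ≠ 1 ∧
      ∀ α : Coprod G (Multiplicative ℤ) →* G, α u ≠ 1 → ∀ w ∈ s, α w ≠ 1 by
    obtain ⟨u, hu, h⟩ := h
    obtain ⟨α, h1, h2⟩ := hG.exists_hom hu
    exact ⟨α, h1, h α h2⟩
  induction s using Finset.induction_on with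
  | empty =>
    obtain ⟨g, hg⟩ := @exists_ne G hG.nontrivial 1
    exact ⟨Coprod.inl g, fun h => hg (Coprod.inl_injective (by simpa using h)), by simp⟩
  | insert w s _ ih =>
    obtain ⟨u, hu, h⟩ := ih fun w hw => hs w (Finset.mem_insert_of_mem hw)
    obtain ⟨c, hc⟩ := hG.exists_commutator_conj_ne_one (hs w (Finset.mem_insert_self _ _)) hu
    refine ⟨_, hc, fun α hα x hx hx1 => hα ?_⟩
    rcases Finset.mem_insert.1 hx with rfl | hx
    · simp [hx1]
    · have : α u = 1 := by
        by_contra h'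
        exact h α h' x hx hx1
      simp [this]

end MIF

/-! ### Norms from weighted generators. -/

open Monoid

variable {G : Type*} [Group G]

/-- A norm on a group with values in the natural numbers. -/
structure IsNatNorm (ℓ : G → ℕ) : Prop where
  eq_zero_iff : ∀ g, ℓ g = 0 ↔ g = 1
  inv : ∀ g, ℓ g⁻¹ = ℓ g
  mul : ∀ g h, ℓ (g * h) ≤ ℓ g + ℓ h

/-- The left invariant metric of a norm. -/
def normDist (ℓ : G → ℕ) (g h : G) : ℕ := ℓ (g⁻¹ * h)

theorem IsNatNorm.isNatMetric {ℓ : G → ℕ} (hℓ : IsNatNorm ℓ) : IsNatMetric (normDist ℓ) where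
  eq_zero_iff g h := by rw [normDist, hℓ.eq_zero_iff, inv_mul_eq_one]
  symm g h := by rw [normDist, ← hℓ.inv, normDist]; simp
  triangle g h k := by
    simpa [normDist, mul_assoc] using hℓ.mul (g⁻¹ * h) (h⁻¹ * k)

theorem isNatNorm_discrete [DecidableEq G] : IsNatNorm fun g : G => if g = 1 then 0 else 1 where
  eq_zero_iff g := by simp
  inv g := by simp
  mul g h := by
    by_cases hg : g = 1
    · simp [hg]
    · simp only [hg, if_false]
      split_ifs <;> omega

section WordNorm

/-- The total weights of the words over a set of weighted generators that represent `h`. -/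
def wordWeights {H : Type*} [Group H] (W : Set (H × ℕ)) (h : H) : Set ℕ :=
  {n | ∃ L : List (H × ℕ), (∀ p ∈ L, p ∈ W) ∧ (L.map Prod.fst).prod = h ∧
    (L.map Prod.snd).sum = n}

/-- The norm given by weighted generators. -/
noncomputable def wordNorm (W : Set (G × ℕ)) (h : G) : ℕ := sInf (wordWeights W h)

variable {W : Set (G × ℕ)}

theorem wordNorm_le {h : G} {n : ℕ} (hp : (h, n) ∈ W) : wordNorm W h ≤ n :=
  Nat.sInf_le ⟨[(h, n)], by simpa using hp, by simp, by simp⟩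

theorem wordWeights_inv (hinv : ∀ p ∈ W, (p.1⁻¹, p.2) ∈ W) {h : G} {n : ℕ}
    (hn : n ∈ wordWeights W h) : n ∈ wordWeights W h⁻¹ := by
  obtain ⟨L, h1, rfl, rfl⟩ := hn
  refine ⟨(L.map fun p => (p.1⁻¹, p.2)).reverse, ?_, ?_, ?_⟩
  · intro p hp
    simp only [List.mem_reverse, List.mem_map] at hp
    obtain ⟨q, hq, rfl⟩ := hp
    exact hinv q (h1 q hq)
  · rw [List.prod_inv_reverse, List.map_reverse, List.map_map, List.map_map]
    rfl
  · rw [List.map_reverse, List.sum_reverse, List.map_map]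
    rfl

theorem isNatNorm_wordNorm (hinv : ∀ p ∈ W, (p.1⁻¹, p.2) ∈ W) (hpos : ∀ p ∈ W, 0 < p.2)
    (htot : ∀ h, ∃ n, (h, n) ∈ W) : IsNatNorm (wordNorm W) := by
  -- Nonemptiness makes the infimum an attained minimum, rather than the default value 0 of `sInf
  -- ∅`.
  have hne : ∀ h, (wordWeights W h).Nonempty := fun h => by
    obtain ⟨n, hn⟩ := htot h
    exact ⟨n, [(h, n)], by simpa using hn, by simp, by simp⟩
  refine ⟨fun g => ⟨fun h => ?_, ?_⟩, fun g => ?_, fun g h => ?_⟩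
  · obtain ⟨L, h1, rfl, h2⟩ := Nat.sInf_mem (hne g)
    rw [wordNorm] at h
    rw [h] at h2
    cases L with
    | nil => simp
    | cons p L =>
      have := hpos p (h1 p (by simp))
      simp only [List.map_cons, List.sum_cons] at h2
      omega
  · rintro rfl
    exact Nat.le_zero.1 (Nat.sInf_le ⟨[], by simp, by simp, by simp⟩)
  · apply le_antisymm
    · exact Nat.sInf_le (wordWeights_inv hinv (Nat.sInf_mem (hne g)))
    · have := Nat.sInf_le (wordWeights_inv hinv (Nat.sInf_mem (hne g⁻¹)))
      rwa [inv_inv] at this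
  · obtain ⟨L, h1, h2, h3⟩ := Nat.sInf_mem (hne g)
    obtain ⟨L', h1', h2', h3'⟩ := Nat.sInf_mem (hne h)
    refine Nat.sInf_le ⟨L ++ L', ?_, by simp [h2, h2'], ?_⟩
    · intro p hp
      rcases List.mem_append.1 hp with hp | hp
      · exact h1 p hp
      · exact h1' p hp
    · rw [List.map_append, List.sum_append, h3, h3']
      rfl

end WordNorm

/-- A finite set of weighted words in `G ∗ ℤ` whose weights cannot be shortened in `G ∗ ℤ` is
realized by a bounded norm on `G` after evaluating the free variable in `G`. -/
theorem IsMIF.exists_norm (hG : IsMIF G) (T : Finset (Coprod G (Multiplicative ℤ) × ℕ))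
    (hinv : ∀ p ∈ T, (p.1⁻¹, p.2) ∈ T) (hpos : ∀ p ∈ T, 0 < p.2)
    (hmin : ∀ p ∈ T, ∀ n ∈ wordWeights (T : Set (Coprod G (Multiplicative ℤ) × ℕ)) p.1,
      p.2 ≤ n) :
    ∃ (α : Coprod G (Multiplicative ℤ) →* G) (ℓ : G → ℕ), (∀ g, α (Coprod.inl g) = g) ∧
      IsNatNorm ℓ ∧ (∃ N, ∀ g, ℓ g ≤ N) ∧ ∀ p ∈ T, ℓ (α p.1) = p.2 := by
  classical
  obtain ⟨N, hN0, hN⟩ : ∃ N, 0 < N ∧ ∀ p ∈ T, p.2 ≤ N :=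
    ⟨T.sup Prod.snd + 1, Nat.succ_pos _, fun p hp => (Finset.le_sup hp).trans (Nat.le_succ _)⟩
  let words : Set (List T) := {L | L.length ≤ N}
  have hfin : words.Finite := List.finite_length_le _ N
  let val : List T → Coprod G (Multiplicative ℤ) := fun L => (L.map fun p => p.1.1).prod
  -- The non-trivial discrepancies between a word of at most N letters and a generator. If α keeps
  -- them alive, short relations in G lift to G ∗ ℤ.
  let K := ((hfin.toFinset ×ˢ T).image fun q => val q.1 * q.2.1⁻¹).filter (· ≠ 1)
  obtain ⟨α, hα, hK⟩ := hG.exists_hom_forall K (by simp [K])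
  -- Giving every element the additional weight N bounds the norm, and undercuts nothing as N
  -- dominates the weights in T.
  let W : Set (G × ℕ) := {q | (∃ p ∈ T, (α p.1, p.2) = q) ∨ q.2 = N}
  refine ⟨α, wordNorm W, hα, ?_, ⟨N, fun g => wordNorm_le (Or.inr rfl)⟩, fun p hp =>
    le_antisymm (wordNorm_le (Or.inl ⟨p, hp, rfl⟩)) ?_⟩
  · refine isNatNorm_wordNorm ?_ ?_ fun h => ⟨N, Or.inr rfl⟩
    · rintro q (⟨p, hp, rfl⟩ | hq)
      · exact Or.inl ⟨_, hinv p hp, by simp⟩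
      · exact Or.inr hq
    · rintro q (⟨p, hp, rfl⟩ | hq)
      · exact hpos p hp
      · exact hq ▸ hN0
  · refine le_csInf ⟨N, [(α p.1, N)], ?_, by simp, by simp⟩ ?_
    · intro q hq
      exact Or.inr (by simp_all)
    · rintro n ⟨L, hL, hprod, rfl⟩
      by_cases hLN : ∃ q ∈ L, q.2 = N
      · obtain ⟨q, hq, hqN⟩ := hLN
        exact (hN p hp).trans (hqN ▸ List.single_le_sum (by simp) _ (List.mem_map_of_mem hq))
      · push Not at hLN
        have hr : L ∈ Set.range (List.map fun p : T => (α p.1.1, p.1.2)) := by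
          rw [Set.range_list_map]
          intro q hq
          rcases hL q hq with ⟨p, hp, h⟩ | h
          · exact ⟨⟨p, hp⟩, h⟩
          · exact absurd h (hLN q hq)
        obtain ⟨L', rfl⟩ := hr
        simp only [List.map_map] at hprod ⊢
        by_cases hlen : L'.length ≤ N
        · have h1 : α (val L' * p.1⁻¹) = 1 := by
            rw [map_mul, map_inv, ← hprod, mul_inv_eq_one, map_list_prod, List.map_map]
            rfl
          have h2 : val L' * p.1⁻¹ = 1 := by
            by_contra h
            refine hK _ (Finset.mem_filter.2 ⟨Finset.mem_image.2 ⟨(L', p), ?_, rfl⟩, h⟩) h1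
            exact Finset.mem_product.2 ⟨hfin.mem_toFinset.2 hlen, hp⟩
          refine hmin p hp _ ⟨L'.map Subtype.val, ?_, ?_, ?_⟩
          · intro q hq
            obtain ⟨t, -, rfl⟩ := List.mem_map.1 hq
            exact t.2
          · rw [List.map_map]
            exact mul_inv_eq_one.1 h2
          · rw [List.map_map]
            rfl
        -- Weights are at least 1, so more than N letters already cost more than N.
        · have h3 := List.length_le_sum_of_one_le
            (L'.map (Prod.snd ∘ fun p : T => (α p.1.1, p.1.2))) (by
              intro i hi
              obtain ⟨t, -, rfl⟩ := List.mem_map.1 hi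
              exact hpos _ t.2)
          rw [List.length_map] at h3
          have := hN p hp
          omega

/-! ### An isometric action of G ∗ ℤ and the extension step. -/

section Translations

/-- Uniform closeness of integer valued functions. -/
def Close {X : Type*} (n : ℕ) (u v : X → ℤ) : Prop := ∀ k, |u k - v k| ≤ n

theorem Close.trans {X : Type*} {m n : ℕ} {u v w : X → ℤ} (h : Close m u v) (h' : Close n v w) :
    Close (m + n) u w := fun k => by
  have := abs_sub_le (u k) (v k) (w k)
  have := h k
  have := h' k
  push_cast
  omega

theorem Close.symm {X : Type*} {n : ℕ} {u v : X → ℤ} (h : Close n u v) : Close n v u :=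
  fun k => by rw [abs_sub_comm]; exact h k

/-- Left translation of functions on a group. -/
def translate (G : Type*) [Group G] : G →* Equiv.Perm (G → ℤ) where
  toFun g :=
    ⟨fun u k => u (g⁻¹ * k), fun u k => u (g * k), fun u => by simp, fun u => by simp⟩
  map_one' := by ext; simp
  map_mul' g h := by ext; simp [mul_assoc]

/-- The action of `G ∗ ℤ` on functions where `G` translates and `ℤ` adds multiples of `b`. -/
def translateAdd (b : G → ℤ) : Coprod G (Multiplicative ℤ) →* Equiv.Perm (G → ℤ) :=
  Coprod.lift (translate G) (zpowersHom _ (Equiv.addRight b))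

theorem translateAdd_inl (b : G → ℤ) (g : G) (u : G → ℤ) (k : G) :
    translateAdd b (Coprod.inl g) u k = u (g⁻¹ * k) := by
  simp [translateAdd, translate]

theorem translateAdd_inr (b u : G → ℤ) :
    translateAdd b (Coprod.inr (Multiplicative.ofAdd 1)) u = u + b := by
  simp [translateAdd]

theorem Close.translateAdd (b : G → ℤ) (t : Coprod G (Multiplicative ℤ)) :
    ∀ (n : ℕ) (u v : G → ℤ), Close n u v →
      Close n (MossReps.translateAdd b t u) (MossReps.translateAdd b t v) := by
  induction t using Coprod.induction_on with
  | inl g =>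
    intro n u v h k
    rw [translateAdd_inl, translateAdd_inl]
    exact h _
  | inr z =>
    intro n u v h
    have : ∀ (u : G → ℤ), MossReps.translateAdd b (Coprod.inr z) u =
        u + Multiplicative.toAdd z • b := by
      intro u
      simp [MossReps.translateAdd]
    rw [this, this]
    intro k
    simpa using h k
  | mul x y hx hy =>
    intro n u v h
    rw [map_mul]
    exact hx _ _ _ (hy _ _ _ h)

/-- The source of lower bounds on weights: if each generator moves y by at most its weight, a word
moves y by at most its total weight, because the action is isometric. -/
theorem close_of_mem_wordWeights (b y : G → ℤ) {T : Set (Coprod G (Multiplicative ℤ) × ℕ)}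
    (hT : ∀ p ∈ T, Close p.2 (translateAdd b p.1 y) y) {t : Coprod G (Multiplicative ℤ)} {n : ℕ}
    (hn : n ∈ wordWeights T t) : Close n (translateAdd b t y) y := by
  obtain ⟨L, hL, rfl, rfl⟩ := hn
  induction L with
  | nil => intro k; simp
  | cons p L ih =>
    simp only [List.map_cons, List.prod_cons, List.sum_cons, map_mul]
    have h1 := hT p (hL p (by simp))
    have h2 := ih fun q hq => hL q (by simp [hq])
    rw [add_comm]
    exact (Close.translateAdd b p.1 _ _ _ h2).trans h1

end Translations

/-- A norm can be changed off a finite set so that a prescribed one-point extension is realized. -/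
theorem IsMIF.exists_norm_extension (hG : IsMIF G) {ℓ : G → ℕ} (hℓ : IsNatNorm ℓ) (F : Finset G)
    (s : Finset (G × ℕ)) (hs : IsKatetov (normDist ℓ) s) :
    ∃ ℓ' : G → ℕ, IsNatNorm ℓ' ∧ (∃ N, ∀ g, ℓ' g ≤ N) ∧ (∀ g ∈ F, ℓ' g = ℓ g) ∧
      ∃ v, ∀ p ∈ s, normDist ℓ' v p.1 = p.2 := by
  classical
  -- p extends the prescribed distances to all of G by the infimum formula; for empty s it is
  -- irrelevant and set to 0.
  obtain ⟨p, hpge, hple⟩ : ∃ p : G → ℕ, (∀ k, s.Nonempty → ∃ q ∈ s, p k = q.2 + ℓ (q.1⁻¹ * k)) ∧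
      ∀ k, ∀ q ∈ s, p k ≤ q.2 + ℓ (q.1⁻¹ * k) := by
    by_cases hne : s.Nonempty
    · refine ⟨fun k => s.inf' hne fun q => q.2 + ℓ (q.1⁻¹ * k), fun k _ => ?_, fun k q hq =>
        Finset.inf'_le _ hq⟩
      obtain ⟨q, hq, h⟩ := Finset.exists_mem_eq_inf' hne fun q => q.2 + ℓ (q.1⁻¹ * k)
      exact ⟨q, hq, h⟩
    · rw [Finset.not_nonempty_iff_eq_empty] at hne
      subst hne
      exact ⟨fun _ => 0, fun _ h => absurd h (by simp), by simp⟩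
  let y : G → ℤ := fun k => ℓ k
  -- Chosen so that x sends y = ℓ, the distance function of 1, to p, the would-be distance function
  -- of the new point.
  let b : G → ℤ := fun k => p k - ℓ k
  let x : Coprod G (Multiplicative ℤ) := Coprod.inr (Multiplicative.ofAdd 1)
  have hx : ∀ q k, translateAdd b (Coprod.inl q⁻¹ * x) y k = p (q * k) := by
    intro q k
    rw [map_mul, Equiv.Perm.mul_apply, translateAdd_inl, translateAdd_inr]
    simp [y, b]
  let T₁ : Finset (Coprod G (Multiplicative ℤ) × ℕ) :=
    ((F ∪ F.image (·⁻¹)).erase 1).image fun g => (Coprod.inl g, ℓ g)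
  let T₂ : Finset (Coprod G (Multiplicative ℤ) × ℕ) :=
    s.image fun q => (Coprod.inl q.1⁻¹ * x, q.2)
  let T₃ : Finset (Coprod G (Multiplicative ℤ) × ℕ) := T₂.image fun t => (t.1⁻¹, t.2)
  have close_inv : ∀ (n : ℕ) (t : Coprod G (Multiplicative ℤ)),
      Close n (translateAdd b t y) y → Close n (translateAdd b t⁻¹ y) y := by
    intro n t h
    have := (Close.translateAdd b t⁻¹ _ _ _ h).symm
    rwa [← Equiv.Perm.mul_apply, ← map_mul, inv_mul_cancel, map_one, Equiv.Perm.one_apply] at this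
  have cl₁ : ∀ t ∈ T₁, Close t.2 (translateAdd b t.1 y) y := by
    simp only [T₁, Finset.forall_mem_image]
    intro g _ k
    rw [translateAdd_inl, abs_le]
    have h1 := hℓ.mul g⁻¹ k
    have h2 := hℓ.mul g (g⁻¹ * k)
    rw [hℓ.inv] at h1
    rw [mul_inv_cancel_left] at h2
    simp only [y]
    omega
  have cl₂ : ∀ t ∈ T₂, Close t.2 (translateAdd b t.1 y) y := by
    simp only [T₂, Finset.forall_mem_image]
    intro q hq k
    rw [hx, abs_le]
    simp only [y]
    have h1 := hple (q.1 * k) q hq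
    obtain ⟨r, hr, h2⟩ := hpge (q.1 * k) ⟨q, hq⟩
    have h3 := (hs.2 q hq r hr).2
    have h4 := hℓ.mul (q.1⁻¹ * r.1) (r.1⁻¹ * (q.1 * k))
    rw [normDist] at h3
    rw [inv_mul_cancel_left] at h1
    rw [show q.1⁻¹ * r.1 * (r.1⁻¹ * (q.1 * k)) = k by group] at h4
    omega
  -- Evaluation at 1, where ℓ vanishes, shows that each generator moves y by its full weight.
  have low₁ : ∀ t ∈ T₁, ∀ n, Close n (translateAdd b t.1 y) y → t.2 ≤ n := by
    simp only [T₁, Finset.forall_mem_image]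
    intro g _ n h
    have := h 1
    rw [translateAdd_inl] at this
    simpa [y, (hℓ.eq_zero_iff 1).2 rfl, hℓ.inv] using this
  have low₂ : ∀ t ∈ T₂, ∀ n, Close n (translateAdd b t.1 y) y → t.2 ≤ n := by
    simp only [T₂, Finset.forall_mem_image]
    intro q hq n h
    have h1 := h 1
    rw [hx] at h1
    obtain ⟨r, hr, h2⟩ := hpge q.1 ⟨q, hq⟩
    have h3 := (hs.2 q hq r hr).1
    have h4 := hℓ.isNatMetric.symm q.1 r.1
    simp only [normDist] at h3 h4
    simp only [y, (hℓ.eq_zero_iff 1).2 rfl, mul_one, abs_le] at h1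
    omega
  obtain ⟨α, ℓ', hα, hℓ', hbdd, hT⟩ := hG.exists_norm (T₁ ∪ T₂ ∪ T₃) (by
    intro t ht
    rw [Finset.mem_union, Finset.mem_union] at ht ⊢
    rcases ht with (ht | ht) | ht
    · left; left
      obtain ⟨g, hg, rfl⟩ := Finset.mem_image.1 ht
      refine Finset.mem_image.2 ⟨g⁻¹, ?_, by simp [hℓ.inv]⟩
      simp only [Finset.mem_erase, Finset.mem_union, Finset.mem_image] at hg ⊢
      refine ⟨by simpa using hg.1, ?_⟩
      rcases hg.2 with h | ⟨h, hh, rfl⟩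
      · exact Or.inr ⟨g, h, rfl⟩
      · exact Or.inl (by simpa using hh)
    · right
      exact Finset.mem_image_of_mem _ ht
    · left; right
      obtain ⟨t', ht', rfl⟩ := Finset.mem_image.1 ht
      simpa using ht') (by
    intro t ht
    rw [Finset.mem_union, Finset.mem_union] at ht
    have h₂ : ∀ t ∈ T₂, 0 < t.2 := by
      simp only [T₂, Finset.forall_mem_image]
      exact fun q hq => hs.1 q hq
    rcases ht with (ht | ht) | ht
    · obtain ⟨g, hg, rfl⟩ := Finset.mem_image.1 ht
      rw [Nat.pos_iff_ne_zero, Ne, hℓ.eq_zero_iff]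
      exact (Finset.mem_erase.1 hg).1
    · exact h₂ t ht
    · obtain ⟨t', ht', rfl⟩ := Finset.mem_image.1 ht
      exact h₂ t' ht') (by
    intro t ht n hn
    have hcl := close_of_mem_wordWeights b y (fun t ht => by
      rw [Finset.mem_coe, Finset.mem_union, Finset.mem_union] at ht
      rcases ht with (ht | ht) | ht
      · exact cl₁ t ht
      · exact cl₂ t ht
      · obtain ⟨t', ht', rfl⟩ := Finset.mem_image.1 ht
        exact close_inv _ _ (cl₂ t' ht')) hn
    rw [Finset.mem_union, Finset.mem_union] at ht
    rcases ht with (ht | ht) | ht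
    · exact low₁ t ht n hcl
    · exact low₂ t ht n hcl
    · obtain ⟨t', ht', rfl⟩ := Finset.mem_image.1 ht
      refine low₂ t' ht' n ?_
      simpa using close_inv _ _ hcl)
  refine ⟨ℓ', hℓ', hbdd, fun g hg => ?_, α x, fun q hq => ?_⟩
  · by_cases h1 : g = 1
    · rw [(hℓ.eq_zero_iff g).2 h1, (hℓ'.eq_zero_iff g).2 h1]
    · have := hT (Coprod.inl g, ℓ g) (by
        rw [Finset.mem_union, Finset.mem_union]
        left; left
        exact Finset.mem_image.2 ⟨g, by simp [h1, hg], rfl⟩)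
      rwa [hα] at this
  · have := hT (Coprod.inl q.1⁻¹ * x, q.2) (by
      rw [Finset.mem_union, Finset.mem_union]
      left; right
      exact Finset.mem_image.2 ⟨q, hq, rfl⟩)
    rw [map_mul, hα] at this
    rw [hℓ'.isNatMetric.symm]
    exact this

/-! ### Baire category in the space of norms. -/

section Generic

variable {G : Type*} [Group G]

/-- The space of norms on a group, with the topology of pointwise convergence. -/
abbrev Norms (G : Type*) [Group G] := {ℓ : G → ℕ // IsNatNorm ℓ}

theorem isClosed_isNatNorm : IsClosed {ℓ : G → ℕ | IsNatNorm ℓ} := by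
  have : {ℓ : G → ℕ | IsNatNorm ℓ} = ((⋂ g, {ℓ | ℓ g = 0 ↔ g = 1}) ∩ ⋂ g, {ℓ | ℓ g⁻¹ = ℓ g}) ∩
      ⋂ g, ⋂ h, {ℓ | ℓ (g * h) ≤ ℓ g + ℓ h} := by
    ext ℓ
    simp only [Set.mem_ofPred_eq, Set.mem_inter_iff, Set.mem_iInter]
    exact ⟨fun h => ⟨⟨h.1, h.2⟩, h.3⟩, fun h => ⟨h.1.1, h.1.2, h.2⟩⟩
  rw [this]
  refine ((isClosed_iInter fun g => ?_).inter (isClosed_iInter fun g => ?_)).inter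
    (isClosed_iInter fun g => isClosed_iInter fun h => ?_)
  · exact (isClosed_discrete {n : ℕ | n = 0 ↔ g = 1}).preimage
      (continuous_apply g : Continuous fun ℓ : G → ℕ => ℓ g)
  · exact isClosed_eq (continuous_apply _) (continuous_apply _)
  · exact isClosed_le (f := fun ℓ : G → ℕ => ℓ (g * h)) (g := fun ℓ => ℓ g + ℓ h)
      (by fun_prop) (by fun_prop)

theorem isOpen_agree (ℓ : Norms G) (F : Finset G) :
    IsOpen {ℓ' : Norms G | ∀ g ∈ F, ℓ'.1 g = ℓ.1 g} := by
  have : {ℓ' : Norms G | ∀ g ∈ F, ℓ'.1 g = ℓ.1 g} =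
      ⋂ g ∈ F, (fun ℓ' : Norms G => ℓ'.1 g) ⁻¹' {ℓ.1 g} := by
    ext; simp
  rw [this]
  exact isOpen_biInter_finset fun g _ => (isOpen_discrete _).preimage
    ((continuous_apply g).comp continuous_subtype_val)

theorem isOpen_of_agree {D : Set (Norms G)}
    (h : ∀ ℓ ∈ D, ∃ F : Finset G, ∀ ℓ' : Norms G, (∀ g ∈ F, ℓ'.1 g = ℓ.1 g) → ℓ' ∈ D) :
    IsOpen D := by
  rw [isOpen_iff_mem_nhds]
  intro ℓ hℓ
  obtain ⟨F, hF⟩ := h ℓ hℓ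
  exact Filter.mem_of_superset ((isOpen_agree ℓ F).mem_nhds fun _ _ => rfl) hF

theorem dense_of_agree {D : Set (Norms G)}
    (h : ∀ (ℓ : Norms G) (F : Finset G), ∃ ℓ' ∈ D, ∀ g ∈ F, ℓ'.1 g = ℓ.1 g) : Dense D := by
  rw [dense_iff_inter_open]
  rintro U hU ⟨ℓ, hℓ⟩
  obtain ⟨V, hV, rfl⟩ := isOpen_induced_iff.1 hU
  obtain ⟨F, u, hu, hsub⟩ := isOpen_pi_iff.1 hV ℓ.1 hℓ
  obtain ⟨ℓ', hD, hF⟩ := h ℓ F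
  exact ⟨ℓ', hsub fun g hg => by rw [hF g hg]; exact (hu g hg).2, hD⟩

theorem isKatetov_congr {X : Type*} {d d' : X → X → ℕ} {s : Finset (X × ℕ)}
    (h : ∀ p ∈ s, ∀ q ∈ s, d' p.1 q.1 = d p.1 q.1) (hs : IsKatetov d' s) : IsKatetov d s :=
  ⟨hs.1, fun p hp q hq => by rw [← h p hp q hq]; exact hs.2 p hp q hq⟩

/-- The norms that realize a given one-point extension, if it is consistent with them. -/
def realizing (s : Finset (G × ℕ)) : Set (Norms G) :=
  {ℓ | IsKatetov (normDist ℓ.1) s → ∃ v, ∀ p ∈ s, normDist ℓ.1 v p.1 = p.2}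

theorem isOpen_realizing (s : Finset (G × ℕ)) : IsOpen (realizing s) := by
  classical
  refine isOpen_of_agree fun ℓ hℓ => ?_
  by_cases hs : IsKatetov (normDist ℓ.1) s
  · obtain ⟨v, hv⟩ := hℓ hs
    refine ⟨s.image fun p => v⁻¹ * p.1, fun ℓ' h _ => ⟨v, fun p hp => ?_⟩⟩
    rw [← hv p hp]
    exact h _ (Finset.mem_image_of_mem (fun p : G × ℕ => v⁻¹ * p.1) hp)
  · refine ⟨(s ×ˢ s).image fun t => t.1.1⁻¹ * t.2.1, fun ℓ' h hs' => absurd ?_ hs⟩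
    exact isKatetov_congr (fun p hp q hq => h _ (Finset.mem_image_of_mem
      (fun t : (G × ℕ) × (G × ℕ) => t.1.1⁻¹ * t.2.1) (Finset.mk_mem_product hp hq))) hs'

theorem IsMIF.dense_realizing (hG : IsMIF G) (s : Finset (G × ℕ)) : Dense (realizing s) := by
  classical
  refine dense_of_agree fun ℓ F => ?_
  by_cases hs : IsKatetov (normDist ℓ.1) s
  · obtain ⟨ℓ', h1, -, h2, h3⟩ := hG.exists_norm_extension ℓ.2 F s hs
    exact ⟨⟨ℓ', h1⟩, fun _ => h3, h2⟩
  · exact ⟨ℓ, fun h => absurd h hs, fun _ _ => rfl⟩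

/-- There is a bounded norm agreeing with ℓ on F. If it is ℓ itself, realizing a distance beyond its
bound gives a different norm. -/
theorem IsMIF.exists_ne_agree (hG : IsMIF G) (ℓ : Norms G) (F : Finset G) :
    ∃ ℓ' : Norms G, ℓ' ≠ ℓ ∧ ∀ g ∈ F, ℓ'.1 g = ℓ.1 g := by
  obtain ⟨ℓ₁, h1, ⟨N, hN⟩, h2, -⟩ := hG.exists_norm_extension ℓ.2 F ∅ (by simp [IsKatetov])
  by_cases h : ℓ₁ = ℓ.1
  · subst h
    obtain ⟨ℓ₂, h3, -, h4, v, hv⟩ := hG.exists_norm_extension ℓ.2 F {(1, N + 1)}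
      (by simp [IsKatetov, ℓ.2.isNatMetric.self])
    refine ⟨⟨ℓ₂, h3⟩, ?_, h4⟩
    rintro rfl
    have h5 := hv (1, N + 1) (by simp)
    have h6 := hN (v⁻¹ * 1)
    simp only [normDist] at h5 h6
    omega
  · exact ⟨⟨ℓ₁, h1⟩, fun h' => h (congrArg Subtype.val h'), h2⟩

/-- The norms whose metric has all one-point extensions. -/
def genericNorms (G : Type*) [Group G] : Set (Norms G) := {ℓ | HasExtensions (normDist ℓ.1)}

theorem genericNorms_eq : genericNorms G = ⋂ s, realizing s := by
  ext ℓ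
  simp [genericNorms, HasExtensions, realizing]

instance [Countable G] : PolishSpace (Norms G) := isClosed_isNatNorm.polishSpace

theorem IsMIF.not_countable_genericNorms [Countable G] (hG : IsMIF G) :
    ¬ (genericNorms G).Countable := by
  classical
  intro hR
  have : Countable (genericNorms G) := hR.to_subtype
  let := TopologicalSpace.upgradeIsCompletelyMetrizable (Norms G)
  -- If the generic norms were countable, their complements could join the dense open sets, and a
  -- Baire point would be a generic norm missing from the list.
  let E : Finset (G × ℕ) ⊕ genericNorms G → Set (Norms G) :=
    Sum.elim realizing fun r => {r.1}ᶜ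
  have hE : Dense (⋂ i, E i) := by
    refine dense_iInter_of_isOpen ?_ ?_
    · rintro (s | r)
      · exact isOpen_realizing s
      · exact isOpen_compl_singleton
    · rintro (s | r)
      · exact hG.dense_realizing s
      · refine dense_of_agree fun ℓ F => ?_
        by_cases h : ℓ = r.1
        · obtain ⟨ℓ', h1, h2⟩ := hG.exists_ne_agree ℓ F
          exact ⟨ℓ', fun h3 => h1 (Eq.trans h3 h.symm), h2⟩
        · exact ⟨ℓ, h, fun _ _ => rfl⟩
  have : Nonempty (Norms G) := ⟨⟨_, isNatNorm_discrete⟩⟩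
  obtain ⟨ℓ, hℓ⟩ := hE.nonempty
  rw [Set.mem_iInter] at hℓ
  have hmem : ℓ ∈ genericNorms G := by
    rw [genericNorms_eq, Set.mem_iInter]
    exact fun s => hℓ (Sum.inl s)
  exact hℓ (Sum.inr ⟨ℓ, hmem⟩) rfl

/-- Uncountable Borel sets in Polish spaces contain a copy of the Cantor space. -/
theorem exists_injection_of_not_countable {X : Type*} [TopologicalSpace X] [PolishSpace X]
    [MeasurableSpace X] [BorelSpace X] {R : Set X} (hR : MeasurableSet R)
    (hunc : ¬ R.Countable) : ∃ f : (ℕ → Bool) → R, Function.Injective f := by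
  -- A finer Polish topology makes the Borel set closed; only injectivity of the Cantor scheme is
  -- kept.
  obtain ⟨t, -, ht, hclosed, -⟩ := hR.isClopenable
  obtain ⟨f, hf, -, hinj⟩ :=
    @IsClosed.exists_nat_bool_injection_of_not_countable X t ht R hclosed hunc
  exact ⟨fun x => ⟨f x, hf ⟨x, rfl⟩⟩, fun x y h => hinj (congrArg Subtype.val h)⟩

theorem IsMIF.exists_injection_genericNorms [Countable G] (hG : IsMIF G) :
    ∃ f : (ℕ → Bool) → genericNorms G, Function.Injective f := by
  let : MeasurableSpace (Norms G) := borel _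
  have : BorelSpace (Norms G) := ⟨rfl⟩
  refine exists_injection_of_not_countable ?_ hG.not_countable_genericNorms
  rw [genericNorms_eq]
  exact MeasurableSet.iInter fun s => (isOpen_realizing s).measurableSet

end Generic

/-! ### Regular representations from norms. -/

section Representations

variable {G V : Type*} [Group G] {U : SimpleGraph V}

/-- The action of `G` on a graph that is isometric to `G` with a left invariant metric. -/
def leftRep {ℓ : G → ℕ} (e : G ≃ V)
    (he : ∀ g h, U.dist (e g) (e h) = normDist ℓ g h) : G →* (U ≃g U) where
  toFun g :=
    { toEquiv := (e.symm.trans (Equiv.mulLeft g)).trans e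
      map_rel_iff' := by
        intro a b
        obtain ⟨a, rfl⟩ := e.surjective a
        obtain ⟨b, rfl⟩ := e.surjective b
        rw [← SimpleGraph.dist_eq_one_iff_adj, ← SimpleGraph.dist_eq_one_iff_adj, he]
        simp [he, normDist, mul_assoc] }
  map_one' := by
    ext x
    change e (1 * e.symm x) = x
    simp
  map_mul' g h := by
    ext x
    change e (g * h * e.symm x) = e (g * e.symm (e (h * e.symm x)))
    simp [mul_assoc]

variable {ℓ : G → ℕ} (e : G ≃ V)
  (he : ∀ g h, U.dist (e g) (e h) = normDist ℓ g h)

theorem leftRep_apply (g h : G) : leftRep e he g (e h) = e (g * h) := by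
  change e (g * e.symm (e h)) = _
  simp

theorem isRegularRep_leftRep : IsRegularRep (leftRep e he) where
  injective g h hgh := by
    have := congrArg (fun φ : U ≃g U => φ (e 1)) hgh
    simpa [leftRep_apply] using this
  regular u v := by
    obtain ⟨u, rfl⟩ := e.surjective u
    obtain ⟨v, rfl⟩ := e.surjective v
    refine ⟨v * u⁻¹, by simp only [leftRep_apply]; simp, fun g hg => ?_⟩
    simp only [leftRep_apply] at hg
    exact eq_mul_inv_of_mul_eq (e.injective hg)

/-- The norms of equivalent representations are conjugate. -/
theorem exists_conj_of_equivalentReps (hU : U.Connected) {ℓ' : G → ℕ} (e' : G ≃ V)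
    (he' : ∀ g h, U.dist (e' g) (e' h) = normDist ℓ' g h)
    (h : EquivalentReps (leftRep e he) (leftRep e' he')) :
    ∃ k : G, ∀ g, ℓ g = ℓ' (k⁻¹ * g * k) := by
  obtain ⟨t, ht⟩ := h
  -- ℓ g is the displacement of the base point under g; t turns it into the displacement of the
  -- point labelled k.
  obtain ⟨k, hk⟩ := e'.surjective (t (e 1))
  refine ⟨k, fun g => ?_⟩
  have h1 : t (leftRep e he g (e 1)) = leftRep e' he' g (t (e 1)) := by
    rw [ht]
    exact t.apply_symm_apply _
  have h2 := dist_iso hU t (e 1) (leftRep e he g (e 1))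
  rw [h1, ← hk, leftRep_apply, leftRep_apply, he', he] at h2
  simpa [normDist, mul_assoc] using h2.symm

theorem IsMossGraph.exists_isometry [Countable G] (hU : IsMossGraph U) {ℓ : G → ℕ}
    (hℓ : IsNatNorm ℓ) (hE : HasExtensions (normDist ℓ)) :
    ∃ e : G ≃ V, ∀ g h, U.dist (e g) (e h) = normDist ℓ g h := by
  have := hU.countable
  obtain ⟨e, h, -⟩ := PartialIsometry.exists_equiv hℓ.isNatMetric
    (connected_isNatMetric hU.connected) hE hU.hasExtensions ⟨∅, by simp⟩
  exact ⟨e, h⟩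

/-- Conjugacy of norms. -/
def conjSetoid (G : Type*) [Group G] : Setoid (Norms G) where
  r ℓ ℓ' := ∃ k : G, ∀ g, ℓ.1 g = ℓ'.1 (k⁻¹ * g * k)
  iseqv :=
    { refl := fun ℓ => ⟨1, by simp⟩
      symm := fun {ℓ ℓ'} ⟨k, hk⟩ => ⟨k⁻¹, fun g => by rw [hk]; group⟩
      trans := fun {ℓ ℓ' ℓ''} ⟨k, hk⟩ ⟨j, hj⟩ => ⟨k * j, fun g => by
        rw [hk, hj]; group⟩ }

/-- An equivalence relation with countable classes on a set of cardinality of the continuum has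
continuum many classes. -/
theorem mk_quotient_eq_continuum {X : Type*} (r : Setoid X) (hX : Cardinal.mk X = Cardinal.continuum)
    (hr : ∀ x, {y | r y x}.Countable) : Cardinal.mk (Quotient r) = Cardinal.continuum := by
  apply le_antisymm
  · rw [← hX]
    exact Cardinal.mk_quotient_le
  · by_contra! hlt
    have h1 : Cardinal.mk X ≤ Cardinal.mk (Quotient r) * Cardinal.aleph0 := by
      rw [← Cardinal.mk_congr (Equiv.sigmaFiberEquiv (Quotient.mk r)), Cardinal.mk_sigma]
      refine (Cardinal.sum_le_sum _ (fun _ => Cardinal.aleph0) fun q => ?_).trans (by simp)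
      induction q using Quotient.inductionOn with
      | h x =>
        rw [Cardinal.mk_le_aleph0_iff]
        exact ((hr x).mono fun y (hy : Quotient.mk r y = Quotient.mk r x) =>
          Quotient.exact hy).to_subtype
    rw [hX] at h1
    exact absurd (h1.trans_lt (Cardinal.mul_lt_of_lt Cardinal.aleph0_le_continuum hlt
      Cardinal.aleph0_lt_continuum)) (lt_irrefl _)

end Representations

/-! ### Counting, and existence of a Moss graph. -/

theorem IsMIF.mk_genericNorms {G : Type*} [Group G] [Countable G] (hG : IsMIF G) :
    Cardinal.mk (genericNorms G) = Cardinal.continuum := by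
  apply le_antisymm
  · refine (Cardinal.mk_set_le _).trans ((Cardinal.mk_set_le _).trans ?_)
    rw [Cardinal.mk_arrow, ← Cardinal.aleph0_power_aleph0]
    simpa using Cardinal.power_le_power_left Cardinal.aleph0_ne_zero (Cardinal.mk_le_aleph0 (α := G))
  · obtain ⟨f, hf⟩ := hG.exists_injection_genericNorms
    simpa using Cardinal.mk_le_of_injective
      (f := fun x : ULift (ℕ → Bool) => f x.down) (hf.comp ULift.down_injective)

theorem infinite_of_hasExtensions {V : Type*} {d : V → V → ℕ} (hd : IsNatMetric d)
    (hD : HasExtensions d) : Infinite V := by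
  obtain ⟨o, -⟩ := hD ∅ (by simp [IsKatetov])
  have h : ∀ n : ℕ, ∃ v, d v o = n + 1 := fun n => by
    obtain ⟨v, hv⟩ := hD {(o, n + 1)} (by simp [IsKatetov, hd.self])
    exact ⟨v, hv _ (Finset.mem_singleton_self _)⟩
  choose v hv using h
  refine Infinite.of_injective v fun m n hmn => ?_
  have := hv m
  rw [hmn, hv n] at this
  omega

theorem exists_isMossGraph_nat {V : Type*} [Countable V] {d : V → V → ℕ} (hd : IsNatMetric d)
    (hD : HasExtensions d) : ∃ U : SimpleGraph ℕ, IsMossGraph U := by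
  classical
  have := infinite_of_hasExtensions hd hD
  obtain ⟨e⟩ : Nonempty (V ≃ ℕ) := nonempty_equiv_of_countable
  have hd' : IsNatMetric fun m n => d (e.symm m) (e.symm n) :=
    ⟨fun x y => by simp [hd.eq_zero_iff], fun _ _ => hd.symm _ _, fun _ _ _ => hd.triangle _ _ _⟩
  refine ⟨_, isMossGraph_unitGraph hd' fun s hs => ?_⟩
  obtain ⟨v, hv⟩ := hD (s.image fun p => (e.symm p.1, p.2))
    ⟨by simp only [Finset.forall_mem_image]; exact hs.1,
      by simp only [Finset.forall_mem_image]; exact hs.2⟩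
  simp only [Finset.forall_mem_image] at hv
  exact ⟨e v, fun p hp => by simpa using hv hp⟩

end MossReps

theorem corollary1p7 {G : Type*} [Group G] [Countable G] (hG : MossReps.IsMIF G) :
    (∃ U : SimpleGraph ℕ, MossReps.IsMossGraph U) ∧
    ∀ {V : Type*} (U : SimpleGraph V), MossReps.IsMossGraph U →
      ∃ S : Set (G →* (U ≃g U)),
        Cardinal.mk S = Cardinal.continuum ∧
        (∀ α ∈ S, MossReps.IsRegularRep α) ∧
        (∀ α₁ ∈ S, ∀ α₂ ∈ S, α₁ ≠ α₂ → ¬ MossReps.EquivalentReps α₁ α₂) := by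
  constructor
  · obtain ⟨f, -⟩ := hG.exists_injection_genericNorms
    let ℓ := f fun _ => false
    exact MossReps.exists_isMossGraph_nat ℓ.1.2.isNatMetric ℓ.2
  · intro V U hU
    choose e he using fun ℓ : MossReps.genericNorms G => hU.exists_isometry ℓ.1.2 ℓ.2
    let rep : MossReps.genericNorms G → (G →* (U ≃g U)) :=
      fun ℓ => MossReps.leftRep (e ℓ) (he ℓ)
    let r : Setoid (MossReps.genericNorms G) := (MossReps.conjSetoid G).comap Subtype.val
    have hrep : ∀ ℓ ℓ', MossReps.EquivalentReps (rep ℓ) (rep ℓ') → r ℓ ℓ' := fun ℓ ℓ' h =>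
      MossReps.exists_conj_of_equivalentReps _ _ hU.connected _ _ h
    have hr : ∀ ℓ, {ℓ' | r ℓ' ℓ}.Countable := fun ℓ => by
      -- A class consists of conjugates of ℓ, which are indexed by the countable group G.
      refine Set.countable_of_injective_of_countable_image (f := fun ℓ' => ℓ'.1.1)
        (Subtype.val_injective.comp Subtype.val_injective).injOn
        ((Set.countable_range fun k g => ℓ.1.1 (k⁻¹ * g * k)).mono ?_)
      rintro _ ⟨ℓ', ⟨k, hk⟩, rfl⟩
      exact ⟨k, funext fun g => (hk g).symm⟩
    -- One representation per conjugacy class of generic norms.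
    let β : Quotient r → (G →* (U ≃g U)) := fun q => rep q.out
    have hβ : ∀ p q, MossReps.EquivalentReps (β p) (β q) → p = q := fun p q h => by
      rw [← Quotient.out_eq p, ← Quotient.out_eq q]
      exact Quotient.sound (hrep _ _ h)
    refine ⟨Set.range β, ?_, ?_, ?_⟩
    · have hinj : Function.Injective β := fun p q h => hβ p q ⟨1, fun g => by simp [h]⟩
      have := Cardinal.mk_range_eq_of_injective hinj
      rw [MossReps.mk_quotient_eq_continuum r hG.mk_genericNorms hr,
        Cardinal.lift_continuum] at this
      exact Cardinal.lift_injective (this.trans Cardinal.lift_continuum.symm)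
    · rintro _ ⟨q, rfl⟩
      exact MossReps.isRegularRep_leftRep _ _
    · rintro _ ⟨p, rfl⟩ _ ⟨q, rfl⟩ hne h
      exact hne (congrArg β (hβ p q h))
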